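/- Let $\ell\le u$ be real numbers. A dataset is a finite multiset $D$ of points of $[\ell,u]$, of any size $|D|$, with mean $\mu(D)=\frac1{|D|}\sum_{x\in D}x$ when it is non-empty. Two datasets $D,D'$ are neighbors in the add-remove model if $|D\setminus D'|+|D'\setminus D|=1$, and in the swap model if $|D\setminus D'|=|D'\setminus D|=1$ (multiset differences). A randomized estimator $\hat\mu$, which maps every dataset to a random point of $[\ell,u]$, is $\varepsilon$-DP in one of these models if $\Pr[\hat\mu(D)\in S]\le e^{\varepsilon}\Pr[\hat\mu(D')\in S]$ for all datasets $D,D'$ that are neighbors in that model and all measurable $S\subseteq[\ell,u]$. Let $$R_{\mathrm{ar}}(\varepsilon,n_0,\ell,u)=\inf_{\hat\mu}\ \sup_{|D|\ge n_0}\ |D|^2\,\mathbb E\big[(\hat\mu(D)-\mu(D))^2\big],$$ where the infimum is over all estimators that are $\varepsilon$-DP in the add-remove model, and let $R_{\mathrm{sw}}(\varepsilon,n_0,\ell,u)$ be the same quantity for the swap model. Let $o(1)$ denote a term that tends to $0$ as $n_0\to\infty$ and $\varepsilon\to0^+$ such that $n_0\varepsilon\to\infty$, uniformly in $\ell\le u$.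 Then $$R_{\mathrm{ar}}(\varepsilon,n_0,\ell,u)\ \ge\ \frac{2(u-\ell)^2}{\varepsilon^2}\,(1-o(1)).$$ Moreover, the matching upper bound holds, so that $$R_{\mathrm{ar}}(\varepsilon,n_0,\ell,u)=\frac{2(u-\ell)^2}{\varepsilon^2}\,(1\pm o(1)),$$ and the swap model has the same asymptotics: $R_{\mathrm{sw}}(\varepsilon,n_0,\ell,u)=\frac{2(u-\ell)^2}{\varepsilon^2}\,(1\pm o(1))$. -/

import Mathlib

open Filter Topology MeasureTheory
open scoped ENNReal

noncomputable section

namespace PrivateMean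

/-- The datasets of all (finite) sizes, the empty one included, with values in `[l, u]`. -/
abbrev Dataset (l u : ℝ) : Type := Multiset (Set.Icc l u)

/-- The add-remove model: `|D \ D'| + |D' \ D| = 1`, with differences of multisets. -/
def AddRemoveNeighbor {l u : ℝ} (D D' : Dataset l u) : Prop :=
  (D - D').card + (D' - D).card = 1

/-- The swap model: `|D \ D'| = 1` and `|D' \ D| = 1`, with differences of multisets. -/
def SwapNeighbor {l u : ℝ} (D D' : Dataset l u) : Prop :=
  (D - D').card = 1 ∧ (D' - D).card = 1

/-- A randomized mean estimator with values in `[l, u]`, given by the law of its output on each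
dataset. -/
abbrev Estimator (l u : ℝ) : Type := Dataset l u → ProbabilityMeasure (Set.Icc l u)

/-- `ε`-differential privacy with respect to a neighboring relation. -/
def IsDP {l u : ℝ} (nbr : Dataset l u → Dataset l u → Prop) (ε : ℝ) (M : Estimator l u) : Prop :=
  ∀ D D' : Dataset l u, nbr D D' → ∀ S : Set (Set.Icc l u), MeasurableSet S →
    (M D : Measure (Set.Icc l u)) S
      ≤ ENNReal.ofReal (Real.exp ε) * (M D' : Measure (Set.Icc l u)) S

/-- The mean of a dataset (the value `0` at the empty dataset plays no role). -/
def mean {l u : ℝ} (D : Dataset l u) : ℝ :=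
  (D.map (fun x => (x : ℝ))).sum / (D.card : ℝ)

/-- The mean squared error `E[(M(D) - mean(D))²]`, as an extended nonnegative number. -/
def mse {l u : ℝ} (M : Estimator l u) (D : Dataset l u) : ℝ≥0∞ :=
  ∫⁻ y, ENNReal.ofReal (((y : ℝ) - mean D) ^ 2) ∂(M D : Measure (Set.Icc l u))

/-- The normalized mean squared error `|D|² E[(M(D) - mean(D))²]`. -/
def normMSE {l u : ℝ} (M : Estimator l u) (D : Dataset l u) : ℝ≥0∞ :=
  (D.card : ℝ≥0∞) ^ 2 * mse M D

/-- The min-max normalized mean squared error for a neighboring relation: infimum over all `ε`-DP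
estimators of the supremum over all datasets of size at least `n₀`. -/
def minmaxRisk {l u : ℝ} (nbr : Dataset l u → Dataset l u → Prop) (ε : ℝ) (n₀ : ℕ) : ℝ≥0∞ :=
  ⨅ (M : Estimator l u) (_ : IsDP nbr ε M), ⨆ (D : Dataset l u) (_ : n₀ ≤ D.card), normMSE M D

/-- The min-max normalized mean squared error in the add-remove model. -/
def riskAR (ε : ℝ) (n₀ : ℕ) (l u : ℝ) : ℝ≥0∞ :=
  minmaxRisk (l := l) (u := u) AddRemoveNeighbor ε n₀

/-- The min-max normalized mean squared error in the swap model. -/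
def riskSW (ε : ℝ) (n₀ : ℕ) (l u : ℝ) : ℝ≥0∞ :=
  minmaxRisk (l := l) (u := u) SwapNeighbor ε n₀

/-- The asymptotic regime of pairs `(n₀, ε)`: `n₀ → ∞` and `ε → 0` with `ε > 0`, such that
`n₀ ε → ∞`. -/
def regime : Filter (ℕ × ℝ) :=
  ((atTop : Filter ℕ) ×ˢ 𝓝[>] (0 : ℝ)) ⊓ comap (fun p : ℕ × ℝ => (p.1 : ℝ) * p.2) atTop

end PrivateMean

end

/-!
The risk is governed by the Laplace mechanism in both models.

*Lower bound.* Along a chain of datasets `D₀, …, D_K` in which consecutive ones are neighbors, a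
private estimator gives laws `P₀, …, P_K` such that consecutive ones are within a factor `r = e^ε`
of each other. If `Z` estimates the position in the chain, then for each value `z` of `Z` the
densities `q k` of the `P k` at `z` cannot decay faster than `r^(-|k - z|)` away from `z`, so that
`∑ q k (k - z)² / ∑ q k` is at least about `2 / ε²`, the variance of a Laplace variable, up to an
effect of the two ends of the chain. This is shown by linear programming duality. With a function `A = cert r` that vanishes on the negative
half-line, is quadratic on the positive one, and satisfies
`r A(x - 1) - A(x) + r A(-x - 1) - A(-x) ≤ x² - λ`, where `λ = (r + 1) / (r - 1)² ≈ 2 / ε²`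
(`cert_step`), put `x = k - Z`, integrate against `P k` and sum over `k`. By the privacy
constraints the sum telescopes, and only the boundary terms `E A(K - Z)` under `P_K` and `E A(Z)`
under `P₀` remain; they are `O(1 / ε³)`, negligible against `λ K` once `K ε` is large
(`chain_inequality`, `chain_lower_bound`). No densities are needed.

In the swap model the chain consists of the datasets of size `n` with `k` points at `u` and the
others at `l`, for `k ≤ n`. In the add-remove model it consists of the datasets with `n` points at
`l` and `k` points at `u`, for `k ≤ K`, where `K` is a large multiple of `1 / ε` but small compared
to `n`; the size of the dataset then hardly changes along the chain, and `Z` is obtained from the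
estimated mean `v` as the odds `n v / (1 - v)` (`sq_odds_sub_le`).

*Upper bound.* With the data rescaled to `[0, 1]`, the swap model allows to add Laplace noise of
scale `1 / ε` to the sum `S`. In the add-remove model the pair `(S, n - S)` changes by exactly `1` in
`ℓ¹` norm when a point is added, so independent Laplace noises `z₁`, `z₂` of scale `1 / ε` make it
private; the ratio `(S + z₁) / (n + z₁ + z₂)` has an error close to `((1 - m) z₁ - m z₂) / n` with
`m = S / n`, whose second moment is at most `2 / (n ε)²` (`ratio_error_le`).
-/

namespace PrivateMean

/-! ### Second moments along a chain of mutually close distributions -/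

/-- The dual certificate, with `r = e^ε`: on the half-line `x ≥ 0` the function satisfies the
recurrence `r A(x - 1) - A(x) = x² - λ` for `x ≥ 1`, where `λ = (r + 1) / (r - 1)²` is close to
`2 / ε²`, and `A(0) = λ`. -/
noncomputable def cert (r x : ℝ) : ℝ :=
  if 0 ≤ x then x ^ 2 / (r - 1) + 2 * r / (r - 1) ^ 2 * x + (r + 1) / (r - 1) ^ 2 else 0

lemma cert_nonneg {r : ℝ} (hr : 1 < r) (x : ℝ) : 0 ≤ cert r x := by
  have : 0 < r - 1 := sub_pos.2 hr
  unfold cert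
  split_ifs <;> positivity

lemma measurable_cert (r : ℝ) : Measurable (cert r) :=
  Measurable.ite measurableSet_Ici (by fun_prop) measurable_const

/-- By the inequality of arithmetic and geometric means applied to the linear term, the certificate
is bounded by a multiple of `x²` plus a constant. -/
lemma cert_le {r : ℝ} (hr : 1 < r) (x : ℝ) :
    cert r x ≤ (1 + r) / (r - 1) * x ^ 2 + (r / (r - 1) ^ 3 + (r + 1) / (r - 1) ^ 2) := by
  obtain ⟨s, hs, rfl⟩ : ∃ s : ℝ, 0 < s ∧ r = s + 1 := ⟨r - 1, by linarith, by ring⟩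
  unfold cert
  rw [add_sub_cancel_right]
  split_ifs with h
  · have key : (1 + (s + 1)) / s * x ^ 2 + ((s + 1) / s ^ 3 + (s + 1 + 1) / s ^ 2)
        - (x ^ 2 / s + 2 * (s + 1) / s ^ 2 * x + (s + 1 + 1) / s ^ 2)
        = (s + 1) / s ^ 3 * (s * x - 1) ^ 2 := by
      field_simp
      ring
    have : 0 ≤ (s + 1) / s ^ 3 * (s * x - 1) ^ 2 := by positivity
    linarith
  · positivity

lemma cert_step_of_nonneg {r : ℝ} (hr : 1 < r) {x : ℝ} (hx : 0 ≤ x) :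
    r * cert r (x - 1) - cert r x ≤ x ^ 2 - (r + 1) / (r - 1) ^ 2 := by
  obtain ⟨s, hs, rfl⟩ : ∃ s : ℝ, 0 < s ∧ r = s + 1 := ⟨r - 1, by linarith, by ring⟩
  unfold cert
  rw [add_sub_cancel_right, if_pos hx]
  split_ifs with h
  · apply le_of_eq
    field_simp
    ring
  · have h1 : 0 ≤ x ^ 2 / s := by positivity
    have h2 : 0 ≤ 2 * (s + 1) / s ^ 2 * x := by positivity
    nlinarith [sq_nonneg x]

/-- The pointwise inequality of the duality argument: the two one-sided certificates together
stay below `x² - λ`. -/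
lemma cert_step {r : ℝ} (hr : 1 < r) (x : ℝ) :
    r * cert r (x - 1) - cert r x + (r * cert r (-x - 1) - cert r (-x))
      ≤ x ^ 2 - (r + 1) / (r - 1) ^ 2 := by
  have key : ∀ y : ℝ, 0 ≤ y → r * cert r (y - 1) - cert r y + (r * cert r (-y - 1) - cert r (-y))
      ≤ y ^ 2 - (r + 1) / (r - 1) ^ 2 := by
    intro y hy
    have h1 := cert_step_of_nonneg hr hy
    have h2 : cert r (-y - 1) = 0 := by
      unfold cert
      rw [if_neg (by linarith)]
    have h3 := cert_nonneg hr (-y)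
    rw [h2]
    linarith
  rcases le_total 0 x with hx | hx
  · exact key x hx
  · have := key (-x) (by linarith)
    rw [neg_neg, neg_sq] at this
    linarith

/-- Summation of the step inequalities: the interior terms cancel by `hp` and `hm`, and only the
two boundary terms `p K` and `m 0` survive. -/
lemma sum_ge_of_telescope {r lam : ℝ} {e p p' m m' : ℕ → ℝ} (hr : 0 ≤ r) (hp0 : 0 ≤ p' 0)
    (hm0 : ∀ k, 0 ≤ m' k) (K : ℕ) (hp : ∀ k < K, p k ≤ r * p' (k + 1))
    (hm : ∀ k < K, m (k + 1) ≤ r * m' k)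
    (he : ∀ k ≤ K, r * p' k - p k + (r * m' k - m k) ≤ e k - lam) :
    lam * (K + 1) - p K - m 0 ≤ ∑ k ∈ Finset.range (K + 1), e k := by
  have main : ∀ n ≤ K,
      lam * (n + 1) - p n - m 0 + r * m' n ≤ ∑ k ∈ Finset.range (n + 1), e k := by
    intro n
    induction n with
    | zero =>
      intro _
      have h1 := he 0 (Nat.zero_le K)
      have h2 := mul_nonneg hr hp0
      simp only [zero_add, Finset.range_one, Finset.sum_singleton, Nat.cast_zero, mul_one]
      linarith
    | succ n ih =>
      intro hn
      have h1 := ih (by omega)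
      have h2 := he (n + 1) hn
      have h3 := hp n (by omega)
      have h4 := hm n (by omega)
      rw [Finset.sum_range_succ]
      push_cast
      linarith
  have h1 := main K le_rfl
  have h2 := mul_nonneg hr (hm0 K)
  linarith

/-- Expectations of nonnegative functions inherit a multiplicative domination of measures. -/
lemma integral_le_of_le_smul {Ω : Type*} [MeasurableSpace Ω] {P Q : Measure Ω} {r : ℝ}
    (hr : 0 ≤ r) (h : P ≤ ENNReal.ofReal r • Q) {f : Ω → ℝ} (hf : ∀ ω, 0 ≤ f ω)
    (hi : Integrable f Q) : ∫ ω, f ω ∂P ≤ r * ∫ ω, f ω ∂Q := by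
  have h1 := integral_mono_measure h (Eventually.of_forall hf)
    (hi.smul_measure ENNReal.ofReal_ne_top)
  rwa [integral_smul_measure, ENNReal.toReal_ofReal hr, smul_eq_mul] at h1

variable {Ω : Type*} [MeasurableSpace Ω]

/-- If consecutive laws in a chain of length `K` are within a factor `r` of each other and the
second moment of `Z - k` under the `k`-th law is at most `R`, then `R` is at least about
`(r + 1) / (r - 1)²`, up to an error from the two ends of the chain. -/
lemma chain_inequality {K : ℕ} {r B R : ℝ} (hr : 1 < r) {P : ℕ → Measure Ω}
    [∀ k, IsProbabilityMeasure (P k)] {Z : Ω → ℝ} (hZ : Measurable Z) (hB : ∀ ω, |Z ω| ≤ B)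
    (hup : ∀ k < K, P (k + 1) ≤ ENNReal.ofReal r • P k)
    (hdown : ∀ k < K, P k ≤ ENNReal.ofReal r • P (k + 1))
    (hR : ∀ k ≤ K, ∫ ω, (Z ω - k) ^ 2 ∂(P k) ≤ R) :
    (r + 1) / (r - 1) ^ 2 * (K + 1)
        - 2 * ((1 + r) / (r - 1) * R + (r / (r - 1) ^ 3 + (r + 1) / (r - 1) ^ 2))
      ≤ R * (K + 1) := by
  have hs : 0 < r - 1 := sub_pos.2 hr
  have hr0 : 0 ≤ r := by linarith
  have bdd : ∀ (f : Ω → ℝ) (C : ℝ) (k : ℕ), Measurable f → (∀ ω, |f ω| ≤ C) →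
      Integrable f (P k) := fun f C k hf hC =>
    Integrable.of_bound hf.aestronglyMeasurable C (Eventually.of_forall hC)
  have isq : ∀ k j : ℕ, Integrable (fun ω => (Z ω - k) ^ 2) (P j) := by
    intro k j
    refine bdd _ ((B + k) ^ 2) j (by fun_prop) fun ω => ?_
    rw [abs_of_nonneg (sq_nonneg _), ← sq_abs]
    have : |Z ω - k| ≤ B + k := by
      have := abs_sub (Z ω) k
      rw [Nat.abs_cast] at this
      linarith [hB ω]
    gcongr
  have icert : ∀ (g : Ω → ℝ) (C : ℝ) (j : ℕ), Measurable g → (∀ ω, |g ω| ≤ C) →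
      Integrable (fun ω => cert r (g ω)) (P j) := by
    intro g C j hg hC
    refine bdd _ ((1 + r) / (r - 1) * C ^ 2 + (r / (r - 1) ^ 3 + (r + 1) / (r - 1) ^ 2)) j
      ((measurable_cert r).comp hg) fun ω => ?_
    rw [abs_of_nonneg (cert_nonneg hr _)]
    refine (cert_le hr _).trans ?_
    have : g ω ^ 2 ≤ C ^ 2 := sq_le_sq' (abs_le.1 (hC ω)).1 (abs_le.1 (hC ω)).2
    gcongr
  have icertP : ∀ (c : ℝ) (j : ℕ), Integrable (fun ω => cert r (c - Z ω)) (P j) := by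
    intro c j
    refine icert _ (|c| + B) j (by fun_prop) fun ω => ?_
    linarith [abs_sub c (Z ω), hB ω]
  have icertM : ∀ (c : ℝ) (j : ℕ), Integrable (fun ω => cert r (Z ω - c)) (P j) := by
    intro c j
    refine icert _ (|c| + B) j (by fun_prop) fun ω => ?_
    linarith [abs_sub (Z ω) c, hB ω]
  have tele := sum_ge_of_telescope (r := r) (lam := (r + 1) / (r - 1) ^ 2)
    (e := fun k => ∫ ω, (Z ω - k) ^ 2 ∂(P k))
    (p := fun k => ∫ ω, cert r (k - Z ω) ∂(P k))
    (p' := fun k => ∫ ω, cert r (k - 1 - Z ω) ∂(P k))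
    (m := fun k => ∫ ω, cert r (Z ω - k) ∂(P k))
    (m' := fun k => ∫ ω, cert r (Z ω - (k + 1)) ∂(P k)) hr0
    (integral_nonneg fun ω => cert_nonneg hr _)
    (fun k => integral_nonneg fun ω => cert_nonneg hr _) K
    (fun k hk => by
      have := integral_le_of_le_smul hr0 (hdown k hk) (fun ω => cert_nonneg hr (k - Z ω))
        (icertP _ _)
      simpa using this)
    (fun k hk => by
      have := integral_le_of_le_smul hr0 (hup k hk) (fun ω => cert_nonneg hr (Z ω - (k + 1)))
        (icertM _ _)
      simpa using this)
    (fun k _ => by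
      have h := integral_mono (μ := P k)
        ((((icertP (k - 1) k).const_mul r).sub (icertP k k)).add
          (((icertM (k + 1) k).const_mul r).sub (icertM k k)))
        ((isq k k).sub (integrable_const ((r + 1) / (r - 1) ^ 2))) (fun ω => by
          have := cert_step hr (k - Z ω)
          simp only [Pi.add_apply, Pi.sub_apply]
          rw [show (k : ℝ) - 1 - Z ω = k - Z ω - 1 by ring,
            show Z ω - (k + 1) = -(k - Z ω) - 1 by ring, show Z ω - k = -(k - Z ω) by ring,
            neg_sq]
          exact this)
      rw [integral_add' (((icertP (k - 1) k).const_mul r).sub (icertP k k))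
          (((icertM (k + 1) k).const_mul r).sub (icertM k k)),
        integral_sub' ((icertP (k - 1) k).const_mul r) (icertP k k),
        integral_sub' ((icertM (k + 1) k).const_mul r) (icertM k k),
        integral_sub' (isq k k) (integrable_const _), integral_const_mul, integral_const_mul,
        integral_const, probReal_univ, one_smul] at h
      exact h)
  have sumle : ∑ k ∈ Finset.range (K + 1), ∫ ω, (Z ω - k) ^ 2 ∂(P k) ≤ R * (K + 1) := by
    have := Finset.sum_le_card_nsmul (Finset.range (K + 1)) _ R
      (fun k hk => hR k (Nat.lt_succ_iff.1 (Finset.mem_range.1 hk)))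
    rw [Finset.card_range, nsmul_eq_mul] at this
    push_cast at this
    linarith
  have bound : ∀ (g : Ω → ℝ) (j : ℕ), j ≤ K → Integrable (fun ω => cert r (g ω)) (P j) →
      (∀ ω, g ω ^ 2 = (Z ω - j) ^ 2) → ∫ ω, cert r (g ω) ∂(P j)
        ≤ (1 + r) / (r - 1) * R + (r / (r - 1) ^ 3 + (r + 1) / (r - 1) ^ 2) := by
    intro g j hj hi hg
    have h := integral_mono (μ := P j) hi
      (((isq j j).const_mul ((1 + r) / (r - 1))).add
        (integrable_const (r / (r - 1) ^ 3 + (r + 1) / (r - 1) ^ 2)))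
      (fun ω => by
        have := cert_le hr (g ω)
        rw [hg ω] at this
        exact this)
    rw [integral_add' ((isq j j).const_mul _) (integrable_const _), integral_const_mul,
      integral_const, probReal_univ, one_smul] at h
    refine h.trans ?_
    have := hR j hj
    gcongr
  have b1 := bound (fun ω => K - Z ω) K le_rfl (icertP K K) (fun ω => by ring)
  have b2 := bound (fun ω => Z ω - (0 : ℕ)) 0 (Nat.zero_le K) (icertM _ 0) (fun ω => rfl)
  have tele' := tele.trans sumle
  beta_reduce at tele' b1 b2
  linarith

/-- The quantitative lower bound: along a chain of length `K ≥ 100 / (δ ε)` the worst second moment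
exceeds `2 (1 - δ) / ε²`. -/
lemma chain_lower_bound {K : ℕ} {ε δ B : ℝ} (hδ : 0 < δ) (hδ1 : δ ≤ 1) (hε : 0 < ε)
    (hεδ : ε ≤ δ / 10) (hK : 100 / δ ≤ K * ε) {P : ℕ → Measure Ω}
    [∀ k, IsProbabilityMeasure (P k)] {Z : Ω → ℝ} (hZ : Measurable Z) (hB : ∀ ω, |Z ω| ≤ B)
    (hup : ∀ k < K, P (k + 1) ≤ ENNReal.ofReal (Real.exp ε) • P k)
    (hdown : ∀ k < K, P k ≤ ENNReal.ofReal (Real.exp ε) • P (k + 1)) :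
    ∃ k ≤ K, 2 / ε ^ 2 * (1 - δ) < ∫ ω, (Z ω - k) ^ 2 ∂(P k) := by
  by_contra! hR
  have hε1 : ε ≤ 1 := by linarith
  have hs1 : ε ≤ Real.exp ε - 1 := by linarith [Real.add_one_le_exp ε]
  have hs2 : Real.exp ε - 1 ≤ ε * (1 + ε) := by
    have := Real.abs_exp_sub_one_sub_id_le (x := ε) (by rw [abs_of_pos hε]; exact hε1)
    have := (abs_le.1 this).2
    nlinarith
  have h := chain_inequality (r := Real.exp ε) (by linarith) hZ hB hup hdown hR
  obtain ⟨s, hs⟩ : ∃ s, s = Real.exp ε - 1 := ⟨_, rfl⟩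
  have hr : Real.exp ε = s + 1 := by linarith
  rw [hr, add_sub_cancel_right] at h
  rw [← hs] at hs1 hs2
  have hs0 : 0 < s := by linarith
  have hK0 : (0 : ℝ) < K := by
    have : 0 < 100 / δ := by positivity
    exact pos_of_mul_pos_left (this.trans_le hK) hε.le
  have hKs : 100 ≤ δ * (K * s) := by
    have h1 : 100 ≤ δ * (K * ε) := by rwa [div_le_iff₀' hδ] at hK
    have : δ * (K * ε) ≤ δ * (K * s) := by gcongr
    linarith
  have hss : s ≤ 2 * 1 := by nlinarith
  -- Multiplying by `s²` leaves quantities of order `K`.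
  obtain ⟨R, hRdef⟩ : ∃ R, R = 2 / ε ^ 2 * (1 - δ) := ⟨_, rfl⟩
  rw [← hRdef] at h
  have h2 : (s + 1 + 1) * (K - 1) * s - 2 * (s + 1)
      ≤ R * s ^ 2 * (s * (K + 1) + 2 * (1 + (s + 1))) := by
    have := mul_le_mul_of_nonneg_right h (by positivity : 0 ≤ s ^ 3)
    have e1 : ((s + 1 + 1) / s ^ 2 * (K + 1)
        - 2 * ((1 + (s + 1)) / s * R + ((s + 1) / s ^ 3 + (s + 1 + 1) / s ^ 2))) * s ^ 3
        = (s + 1 + 1) * (K - 1) * s - 2 * (s + 1) - 2 * (1 + (s + 1)) * R * s ^ 2 := by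
      field_simp
      ring
    rw [e1] at this
    linarith
  have h3 : R * s ^ 2 ≤ 2 * (1 - δ) * (1 + 0.21 * δ) := by
    have : s ^ 2 ≤ (ε * (1 + ε)) ^ 2 := by gcongr
    have hq : R * s ^ 2 ≤ R * (ε * (1 + ε)) ^ 2 := by
      have : 0 ≤ R := by
        rw [hRdef]
        have : 0 ≤ 1 - δ := by linarith
        positivity
      gcongr
    have he : R * (ε * (1 + ε)) ^ 2 = 2 * (1 - δ) * (1 + ε) ^ 2 := by
      rw [hRdef]
      field_simp
    rw [he] at hq
    refine hq.trans ?_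
    have : (1 + ε) ^ 2 ≤ 1 + 0.21 * δ := by nlinarith
    have h0 : 0 ≤ 2 * (1 - δ) := by linarith
    gcongr
  have hε01 : ε ≤ 0.1 := by linarith
  have hs01 : s ≤ 0.11 := by nlinarith
  have h4 : s * (K + 1) + 2 * (1 + (s + 1)) ≤ (K * s) * (1 + 0.05 * δ) := by nlinarith
  have h5 : 2 * (K * s) * (1 - 0.05 * δ) ≤ (s + 1 + 1) * (K - 1) * s - 2 * (s + 1) := by
    have : 0 ≤ K * s * s := by positivity
    nlinarith
  have h6 : 2 * (K * s) * (1 - 0.05 * δ)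
      ≤ 2 * (1 - δ) * (1 + 0.21 * δ) * ((K * s) * (1 + 0.05 * δ)) := by
    refine (h5.trans h2).trans ?_
    have : 0 ≤ s * (K + 1) + 2 * (1 + (s + 1)) := by positivity
    have h0 : 0 ≤ 1 - δ := by linarith
    gcongr
  have h7 : 1 - 0.05 * δ ≤ (1 - δ) * (1 + 0.21 * δ) * (1 + 0.05 * δ) := by
    have hKs0 : 0 < 2 * (K * s) := by positivity
    refine le_of_mul_le_mul_left (h6.trans (le_of_eq ?_)) hKs0
    ring
  nlinarith [mul_pos hδ hδ, mul_pos (mul_pos hδ hδ) hδ]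

/-! ### Lower bounds for the minimax risk -/

variable {l u : ℝ}

/-- The dataset with `a` points at the left end and `b` points at the right end of `[l, u]`. -/
def twoPoint (h : l ≤ u) (a b : ℕ) : Dataset l u :=
  Multiset.replicate a ⟨l, Set.left_mem_Icc.2 h⟩ + Multiset.replicate b ⟨u, Set.right_mem_Icc.2 h⟩

@[simp]
lemma card_twoPoint (h : l ≤ u) (a b : ℕ) : (twoPoint h a b).card = a + b := by
  simp [twoPoint]

/-- In the definition of the mean, the multiset is coerced to a multiset of reals through the monad
structure on multisets; this is the plain form. -/
lemma mean_eq (D : Dataset l u) : mean D = (Multiset.map Subtype.val D).sum / D.card := by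
  have : (do let a ← D; pure (a : ℝ)) = Multiset.map Subtype.val D :=
    Multiset.bind_singleton D Subtype.val
  unfold mean
  rw [this, Multiset.map_id']

lemma mean_twoPoint (h : l ≤ u) {a b : ℕ} (hab : 0 < a + b) :
    mean (twoPoint h a b) = l + (u - l) * (b / (a + b)) := by
  have : (a : ℝ) + b ≠ 0 := by exact_mod_cast hab.ne'
  rw [mean_eq, card_twoPoint]
  simp only [twoPoint, Multiset.map_add, Multiset.map_replicate, Multiset.sum_add,
    Multiset.sum_replicate, nsmul_eq_mul, Nat.cast_add]
  field_simp
  ring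

lemma addRemoveNeighbor_cons (x : Set.Icc l u) (E : Dataset l u) :
    AddRemoveNeighbor (x ::ₘ E) E ∧ AddRemoveNeighbor E (x ::ₘ E) := by
  have h1 : x ::ₘ E - E = {x} := by
    rw [← Multiset.singleton_add, add_tsub_cancel_right]
  have h2 : E - (x ::ₘ E) = 0 := tsub_eq_zero_of_le (Multiset.le_cons_self E x)
  simp [AddRemoveNeighbor, h1, h2]

lemma swapNeighbor_cons {x y : Set.Icc l u} (hxy : x ≠ y) (E : Dataset l u) :
    SwapNeighbor (x ::ₘ E) (y ::ₘ E) := by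
  have key : ∀ {x y : Set.Icc l u}, x ≠ y → (x ::ₘ E - (y ::ₘ E)) = {x} := by
    intro x y hxy
    rw [← Multiset.singleton_add, ← Multiset.singleton_add, add_tsub_add_eq_tsub_right]
    ext z
    simp only [Multiset.count_sub, Multiset.count_singleton]
    by_cases h1 : z = x <;> by_cases h2 : z = y <;> simp_all
  simp [SwapNeighbor, key hxy, key hxy.symm]

lemma addRemoveNeighbor_twoPoint (h : l ≤ u) (a b : ℕ) :
    AddRemoveNeighbor (twoPoint h a (b + 1)) (twoPoint h a b) ∧
      AddRemoveNeighbor (twoPoint h a b) (twoPoint h a (b + 1)) := by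
  have : twoPoint h a (b + 1) = ⟨u, Set.right_mem_Icc.2 h⟩ ::ₘ twoPoint h a b := by
    simp [twoPoint, Multiset.replicate_succ]
  rw [this]
  exact addRemoveNeighbor_cons _ _

lemma swapNeighbor_twoPoint (h : l < u) (a b : ℕ) :
    SwapNeighbor (twoPoint h.le a (b + 1)) (twoPoint h.le (a + 1) b) ∧
      SwapNeighbor (twoPoint h.le (a + 1) b) (twoPoint h.le a (b + 1)) := by
  have h1 : twoPoint h.le a (b + 1) = ⟨u, Set.right_mem_Icc.2 h.le⟩ ::ₘ twoPoint h.le a b := by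
    simp [twoPoint, Multiset.replicate_succ]
  have h2 : twoPoint h.le (a + 1) b = ⟨l, Set.left_mem_Icc.2 h.le⟩ ::ₘ twoPoint h.le a b := by
    simp [twoPoint, Multiset.replicate_succ]
  rw [h1, h2]
  exact ⟨swapNeighbor_cons (by simp [h.ne']) _, swapNeighbor_cons (by simp [h.ne]) _⟩

lemma IsDP.le_smul {nbr : Dataset l u → Dataset l u → Prop} {ε : ℝ} {M : Estimator l u}
    (hM : IsDP nbr ε M) {D D' : Dataset l u} (h : nbr D D') :
    (M D : Measure (Set.Icc l u)) ≤ ENNReal.ofReal (Real.exp ε) • (M D' : Measure (Set.Icc l u)) :=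
  Measure.le_iff.2 fun S hS => hM D D' h S hS

lemma integrable_sq_sub (P : ProbabilityMeasure (Set.Icc l u)) (c : ℝ) :
    Integrable (fun y : Set.Icc l u => ((y : ℝ) - c) ^ 2) (P : Measure (Set.Icc l u)) := by
  refine Integrable.of_bound (by fun_prop) ((|l| + |u| + |c|) ^ 2) (Eventually.of_forall fun y => ?_)
  rw [Real.norm_eq_abs, abs_of_nonneg (sq_nonneg _)]
  refine sq_le_sq' ?_ ?_
  · linarith [y.2.1, neg_abs_le l, le_abs_self c, abs_nonneg u]
  · linarith [y.2.2, neg_abs_le c, le_abs_self u, abs_nonneg l]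

lemma normMSE_eq_ofReal (M : Estimator l u) (D : Dataset l u) :
    normMSE M D = ENNReal.ofReal ((D.card : ℝ) ^ 2 *
      ∫ y, ((y : ℝ) - mean D) ^ 2 ∂(M D : Measure (Set.Icc l u))) := by
  unfold normMSE mse
  rw [ENNReal.ofReal_mul (by positivity), ENNReal.ofReal_pow (by positivity),
    ENNReal.ofReal_natCast, ofReal_integral_eq_lintegral_ofReal (integrable_sq_sub _ _)
      (Eventually.of_forall fun y => sq_nonneg _)]

lemma le_minmaxRisk {nbr : Dataset l u → Dataset l u → Prop} {ε T : ℝ} {n : ℕ}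
    (h : ∀ M : Estimator l u, IsDP nbr ε M → ∃ D : Dataset l u, n ≤ D.card ∧
      T ≤ (D.card : ℝ) ^ 2 * ∫ y, ((y : ℝ) - mean D) ^ 2 ∂(M D : Measure (Set.Icc l u))) :
    ENNReal.ofReal T ≤ minmaxRisk nbr ε n := by
  refine le_iInf₂ fun M hM => ?_
  obtain ⟨D, hD, hT⟩ := h M hM
  refine le_iSup₂_of_le D hD ?_
  rw [normMSE_eq_ofReal]
  exact ENNReal.ofReal_le_ofReal hT

lemma riskSW_lower_bound {ε δ : ℝ} {n : ℕ} (hδ : 0 < δ) (hδ1 : δ ≤ 1) (hε : 0 < ε)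
    (hεδ : ε ≤ δ / 10) (hn : 100 / δ ≤ n * ε) (hlu : l < u) :
    ENNReal.ofReal (2 * (u - l) ^ 2 / ε ^ 2 * (1 - δ)) ≤ riskSW ε n l u := by
  have hul : 0 < u - l := sub_pos.2 hlu
  have hn0 : (0 : ℝ) < n := by
    have : 0 < 100 / δ := by positivity
    exact pos_of_mul_pos_left (this.trans_le hn) hε.le
  refine le_minmaxRisk fun M hM => ?_
  have nb : ∀ k < n, SwapNeighbor (twoPoint hlu.le (n - (k + 1)) (k + 1))
      (twoPoint hlu.le (n - k) k) ∧ SwapNeighbor (twoPoint hlu.le (n - k) k)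
      (twoPoint hlu.le (n - (k + 1)) (k + 1)) := by
    intro k hk
    rw [show n - k = n - (k + 1) + 1 by omega]
    exact swapNeighbor_twoPoint hlu _ _
  obtain ⟨k, hk, h⟩ := chain_lower_bound (K := n) (B := n) hδ hδ1 hε hεδ hn
    (P := fun k => (M (twoPoint hlu.le (n - k) k) : Measure (Set.Icc l u)))
    (Z := fun y => n * (((y : ℝ) - l) / (u - l))) (by fun_prop)
    (fun y => by
      have h0 : 0 ≤ ((y : ℝ) - l) / (u - l) := div_nonneg (by linarith [y.2.1]) hul.le
      have h1 : ((y : ℝ) - l) / (u - l) ≤ 1 := (div_le_one hul).2 (by linarith [y.2.2])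
      rw [abs_of_nonneg (by positivity)]
      nlinarith)
    (fun k hk => hM.le_smul (nb k hk).1) (fun k hk => hM.le_smul (nb k hk).2)
  refine ⟨twoPoint hlu.le (n - k) k, by rw [card_twoPoint]; omega, ?_⟩
  have hcast : ((n - k : ℕ) : ℝ) + k = n := by
    rw [← Nat.cast_add, Nat.sub_add_cancel hk]
  rw [mean_twoPoint hlu.le (by have : 0 < n := by exact_mod_cast hn0
                               omega), card_twoPoint, Nat.cast_add, hcast]
  have e : ∀ y : Set.Icc l u, ((y : ℝ) - (l + (u - l) * (k / n))) ^ 2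
      = (u - l) ^ 2 / n ^ 2 * (n * (((y : ℝ) - l) / (u - l)) - k) ^ 2 := by
    intro y
    field_simp
    ring
  simp_rw [e]
  rw [integral_const_mul]
  calc 2 * (u - l) ^ 2 / ε ^ 2 * (1 - δ) = (u - l) ^ 2 * (2 / ε ^ 2 * (1 - δ)) := by ring
    _ ≤ (u - l) ^ 2 * _ := mul_le_mul_of_nonneg_left h.le (by positivity)
    _ = _ := by field_simp

/-- The change of variables `z = n v / (1 - v)` turns an estimate `v` of the mean `k / (n + k)` into
an estimate of `k`. Truncating `v` at the largest mean `K / (n + K)` only helps, and makes the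
loss in the change of variables at most a factor `n / (n + K)`. -/
lemma sq_odds_sub_le {n K k v : ℝ} (hn : 0 < n) (hk : 0 ≤ k) (hkK : k ≤ K) (hv : 0 ≤ v) :
    (n / (n + K)) ^ 2 * (n * min v (K / (n + K)) / (1 - min v (K / (n + K))) - k) ^ 2
      ≤ (n + k) ^ 2 * (v - k / (n + k)) ^ 2 ∧
    0 ≤ n * min v (K / (n + K)) / (1 - min v (K / (n + K))) ∧
    n * min v (K / (n + K)) / (1 - min v (K / (n + K))) ≤ K := by
  have hK : 0 ≤ K := hk.trans hkK
  obtain ⟨w, hw⟩ : ∃ w, w = min v (K / (n + K)) := ⟨_, rfl⟩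
  rw [← hw]
  have hw0 : 0 ≤ w := by rw [hw]; exact le_min hv (by positivity)
  have hwK : w ≤ K / (n + K) := by rw [hw]; exact min_le_right _ _
  have hwK' : w * (n + K) ≤ K := by rwa [le_div_iff₀ (by positivity)] at hwK
  have hw1 : 0 < 1 - w := by
    have : K / (n + K) < 1 := (div_lt_one (by positivity)).2 (by linarith)
    linarith
  have hz0 : 0 ≤ n * w / (1 - w) := by positivity
  have hzK : n * w / (1 - w) ≤ K := by
    rw [div_le_iff₀ hw1]
    linarith
  refine ⟨?_, hz0, hzK⟩
  have hmc : k / (n + k) ≤ K / (n + K) := by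
    rw [div_le_div_iff₀ (by positivity) (by positivity)]
    nlinarith
  have hclip : (w - k / (n + k)) ^ 2 ≤ (v - k / (n + k)) ^ 2 := by
    rcases le_total v (K / (n + K)) with h | h
    · rw [hw, min_eq_left h]
    · have : w = K / (n + K) := by rw [hw, min_eq_right h]
      apply pow_le_pow_left₀ <;> linarith
  obtain ⟨z, hz⟩ : ∃ z, z = n * w / (1 - w) := ⟨_, rfl⟩
  rw [← hz] at hz0 hzK ⊢
  have e : (n + k) ^ 2 * (w - k / (n + k)) ^ 2 = (n / (n + z)) ^ 2 * (z - k) ^ 2 := by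
    have hnz : 0 < n + z := by positivity
    have : w = z / (n + z) := by
      rw [eq_div_iff hnz.ne', hz]
      field_simp
      ring
    rw [this]
    field_simp
    ring
  calc (n / (n + K)) ^ 2 * (z - k) ^ 2 ≤ (n / (n + z)) ^ 2 * (z - k) ^ 2 := by gcongr
    _ = (n + k) ^ 2 * (w - k / (n + k)) ^ 2 := e.symm
    _ ≤ _ := by gcongr

/-- The hard datasets have `n` points at `l` and few points, of the order of `1 / ε`, at `u`: adding
a point at `u` shifts their mean by about `(u - l) / n`, as much as any other change does. -/
lemma riskAR_lower_bound {ε δ : ℝ} {n : ℕ} (hδ : 0 < δ) (hδ1 : δ ≤ 1) (hε : 0 < ε)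
    (hεδ : ε ≤ δ / 20) (hn : 2010 / δ ^ 2 ≤ n * ε) (hlu : l < u) :
    ENNReal.ofReal (2 * (u - l) ^ 2 / ε ^ 2 * (1 - δ)) ≤ riskAR ε n l u := by
  have hul : 0 < u - l := sub_pos.2 hlu
  have hn0 : (0 : ℝ) < n := by
    have : 0 < 2010 / δ ^ 2 := by positivity
    exact pos_of_mul_pos_left (this.trans_le hn) hε.le
  -- `K ε` must exceed `100 / (δ / 2)` for the chain bound with `δ / 2`, while `K / n ≤ δ / 10` makes
  -- the factor `(n / (n + K))²` cost at most the other half of `δ`.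
  obtain ⟨K, hK1, hK2⟩ : ∃ K : ℕ, 200 / δ ≤ K * ε ∧ (K : ℝ) ≤ δ / 10 * n := by
    refine ⟨⌈200 / δ / ε⌉₊, ?_, ?_⟩
    · rw [← div_le_iff₀ hε]
      exact Nat.le_ceil _
    · have h1 : (⌈200 / δ / ε⌉₊ : ℝ) < 200 / δ / ε + 1 := Nat.ceil_lt_add_one (by positivity)
      refine h1.le.trans ?_
      have h2 : 2010 / δ ^ 2 / ε ≤ n := by rwa [div_le_iff₀ hε]
      have h3 : δ / 10 * (2010 / δ ^ 2 / ε) = 200 / δ / ε + 1 / (δ * ε) := by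
        field_simp
        norm_num
      have h4 : 1 ≤ 1 / (δ * ε) := by
        rw [le_div_iff₀ (by positivity)]
        nlinarith
      have h5 : δ / 10 * (2010 / δ ^ 2 / ε) ≤ δ / 10 * n := by gcongr
      linarith
  refine le_minmaxRisk fun M hM => ?_
  have hv : ∀ y : Set.Icc l u, 0 ≤ ((y : ℝ) - l) / (u - l) := fun y =>
    div_nonneg (by linarith [y.2.1]) hul.le
  obtain ⟨k, hk, h⟩ := chain_lower_bound (K := K) (B := K) (δ := δ / 2) (by positivity)
    (by linarith) hε (by linarith) (by rw [div_div_eq_mul_div]; linarith)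
    (P := fun k => (M (twoPoint hlu.le n k) : Measure (Set.Icc l u)))
    (Z := fun y => n * min (((y : ℝ) - l) / (u - l)) (K / (n + K))
      / (1 - min (((y : ℝ) - l) / (u - l)) (K / (n + K)))) (by fun_prop)
    (fun y => by
      have := (sq_odds_sub_le hn0 le_rfl (Nat.cast_nonneg K) (hv y)).2
      rw [abs_of_nonneg this.1]
      exact this.2)
    (fun k _ => hM.le_smul (addRemoveNeighbor_twoPoint hlu.le n k).1)
    (fun k _ => hM.le_smul (addRemoveNeighbor_twoPoint hlu.le n k).2)
  refine ⟨twoPoint hlu.le n k, by rw [card_twoPoint]; omega, ?_⟩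
  rw [mean_twoPoint hlu.le (by have : 0 < n := by exact_mod_cast hn0
                               omega), card_twoPoint, Nat.cast_add]
  have hpos : 0 ≤ ((n : ℝ) + k) ^ 2 := by positivity
  have hfac : 1 - δ ≤ (n / (n + K)) ^ 2 * (1 - δ / 2) := by
    have h1 : 1 - δ / 10 ≤ n / (n + K) := by
      rw [le_div_iff₀ (by positivity)]
      nlinarith
    have h2 : (1 - δ / 10) ^ 2 ≤ ((n : ℝ) / (n + K)) ^ 2 := by
      apply pow_le_pow_left₀ _ h1
      linarith
    nlinarith
  have hle : (u - l) ^ 2 * (n / (n + K)) ^ 2 *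
      ∫ y : Set.Icc l u, (n * min (((y : ℝ) - l) / (u - l)) (K / (n + K))
        / (1 - min (((y : ℝ) - l) / (u - l)) (K / (n + K))) - k) ^ 2
          ∂(M (twoPoint hlu.le n k) : Measure (Set.Icc l u))
      ≤ ((n : ℝ) + k) ^ 2 * ∫ y : Set.Icc l u, ((y : ℝ) - (l + (u - l) * (k / (n + k)))) ^ 2
          ∂(M (twoPoint hlu.le n k) : Measure (Set.Icc l u)) := by
    rw [← integral_const_mul, ← integral_const_mul]
    refine integral_mono_of_nonneg (Eventually.of_forall fun y => by positivity)
      ((integrable_sq_sub _ _).const_mul _) (Eventually.of_forall fun y => ?_)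
    have := (sq_odds_sub_le hn0 (Nat.cast_nonneg k) (Nat.cast_le.2 hk) (hv y)).1
    have e : ((n : ℝ) + k) ^ 2 * ((y : ℝ) - (l + (u - l) * (k / (n + k)))) ^ 2
        = (u - l) ^ 2 * ((n + k) ^ 2 * (((y : ℝ) - l) / (u - l) - k / (n + k)) ^ 2) := by
      field_simp
      ring
    beta_reduce
    rw [e, mul_assoc]
    gcongr
  refine le_trans ?_ hle
  calc 2 * (u - l) ^ 2 / ε ^ 2 * (1 - δ)
      ≤ 2 * (u - l) ^ 2 / ε ^ 2 * ((n / (n + K)) ^ 2 * (1 - δ / 2)) := by gcongr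
    _ = (u - l) ^ 2 * (n / (n + K)) ^ 2 * (2 / ε ^ 2 * (1 - δ / 2)) := by ring
    _ ≤ _ := mul_le_mul_of_nonneg_left h.le (by positivity)

/-! ### Additive Laplace noise -/

/-- The law of `s` plus noise with density `g`. -/
noncomputable def shiftNoise {G : Type*} [MeasureSpace G] [AddGroup G] (g : G → ℝ≥0∞) (s : G) :
    Measure G :=
  volume.withDensity fun y => g (y - s)

section Shift

variable {G : Type*} [MeasureSpace G] [AddGroup G] [MeasurableAdd₂ G] [MeasurableSub₂ G]
  [(volume : Measure G).IsAddRightInvariant] {g : G → ℝ≥0∞}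

lemma lintegral_shiftNoise (hg : Measurable g) (s : G) {f : G → ℝ≥0∞} (hf : Measurable f) :
    ∫⁻ y, f y ∂(shiftNoise g s) = ∫⁻ z, g z * f (z + s) := by
  unfold shiftNoise
  rw [lintegral_withDensity_eq_lintegral_mul _ (by fun_prop) hf,
    ← lintegral_add_right_eq_self _ s]
  simp

lemma isProbabilityMeasure_shiftNoise (hg : Measurable g) (h1 : ∫⁻ z, g z = 1) (s : G) :
    IsProbabilityMeasure (shiftNoise g s) :=
  ⟨by rw [← lintegral_one, lintegral_shiftNoise hg s measurable_const]; simpa using h1⟩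

omit [MeasurableAdd₂ G] [(volume : Measure G).IsAddRightInvariant] in
lemma shiftNoise_le (hg : Measurable g) {c : ℝ≥0∞} {s s' : G}
    (h : ∀ y, g (y - s) ≤ c * g (y - s')) : shiftNoise g s ≤ c • shiftNoise g s' := by
  unfold shiftNoise
  rw [← withDensity_smul c (by fun_prop)]
  exact withDensity_mono (Eventually.of_forall h)

end Shift

/-- The density of the centered Laplace distribution with scale `1 / ε`. -/
noncomputable def laplace (ε z : ℝ) : ℝ≥0∞ :=
  ENNReal.ofReal (ε / 2 * Real.exp (-(ε * |z|)))

@[fun_prop]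
lemma measurable_laplace (ε : ℝ) : Measurable (laplace ε) := by
  unfold laplace
  fun_prop

lemma laplace_sub_le {ε : ℝ} (hε : 0 < ε) (y s s' : ℝ) :
    laplace ε (y - s) ≤ ENNReal.ofReal (Real.exp (ε * |s - s'|)) * laplace ε (y - s') := by
  unfold laplace
  rw [← ENNReal.ofReal_mul (Real.exp_pos _).le]
  apply ENNReal.ofReal_le_ofReal
  have h : Real.exp (-(ε * |y - s|)) ≤ Real.exp (ε * |s - s'|) * Real.exp (-(ε * |y - s'|)) := by
    rw [← Real.exp_add]
    apply Real.exp_le_exp.2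
    have : |y - s'| ≤ |y - s| + |s - s'| := abs_sub_le _ _ _
    nlinarith
  calc _ ≤ ε / 2 * (Real.exp (ε * |s - s'|) * Real.exp (-(ε * |y - s'|))) := by gcongr
    _ = _ := by ring

lemma integral_laplace_moment {ε : ℝ} (hε : 0 < ε) (k : ℕ) :
    ∫ z : ℝ, ε / 2 * Real.exp (-(ε * |z|)) * |z| ^ k = (k.factorial : ℝ) / ε ^ k := by
  rw [integral_comp_abs (f := fun z => ε / 2 * Real.exp (-(ε * z)) * z ^ k)]
  have h := Real.integral_rpow_mul_exp_neg_mul_Ioi (a := k + 1) (r := ε) (by positivity) hε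
  have e : ∫ z in Set.Ioi (0 : ℝ), ε / 2 * Real.exp (-(ε * z)) * z ^ k
      = ε / 2 * ∫ z in Set.Ioi (0 : ℝ), z ^ ((k : ℝ) + 1 - 1) * Real.exp (-(ε * z)) := by
    rw [← integral_const_mul]
    congr 1
    ext z
    rw [add_sub_cancel_right, Real.rpow_natCast]
    ring
  rw [e, h, Real.Gamma_nat_eq_factorial, ← Nat.cast_succ, Real.rpow_natCast,
    Nat.succ_eq_add_one, one_div, inv_pow]
  field_simp
  ring

lemma lintegral_laplace_moment {ε : ℝ} (hε : 0 < ε) (k : ℕ) :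
    ∫⁻ z, laplace ε z * ENNReal.ofReal (|z| ^ k) = ENNReal.ofReal ((k.factorial : ℝ) / ε ^ k) := by
  have hI := integral_laplace_moment hε k
  -- A non-integrable function would have integral `0`.
  have hint : Integrable fun z : ℝ => ε / 2 * Real.exp (-(ε * |z|)) * |z| ^ k := by
    by_contra h
    rw [integral_undef h] at hI
    have : 0 < (k.factorial : ℝ) / ε ^ k := by positivity
    linarith
  rw [← hI, ofReal_integral_eq_lintegral_ofReal hint (Eventually.of_forall fun z => by positivity)]
  refine lintegral_congr fun z => ?_
  rw [laplace, ENNReal.ofReal_mul (p := ε / 2 * _) (by positivity)]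

lemma lintegral_laplace {ε : ℝ} (hε : 0 < ε) : ∫⁻ z, laplace ε z = 1 := by
  simpa using lintegral_laplace_moment hε 0

/-- The density of two independent centered Laplace variables with scale `1 / ε`. -/
noncomputable def laplace₂ (ε : ℝ) (z : ℝ × ℝ) : ℝ≥0∞ :=
  laplace ε z.1 * laplace ε z.2

@[fun_prop]
lemma measurable_laplace₂ (ε : ℝ) : Measurable (laplace₂ ε) := by
  unfold laplace₂
  fun_prop

lemma lintegral_laplace₂_fst {ε : ℝ} (hε : 0 < ε) {f : ℝ → ℝ≥0∞} (hf : Measurable f) :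
    ∫⁻ z, laplace₂ ε z * f z.1 = ∫⁻ z, laplace ε z * f z := by
  have h := lintegral_prod_mul (μ := (volume : Measure ℝ)) (ν := (volume : Measure ℝ))
    (f := fun z => laplace ε z * f z) (g := laplace ε) (by fun_prop) (by fun_prop)
  rw [lintegral_laplace hε, mul_one, ← Measure.volume_eq_prod] at h
  rw [← h]
  refine lintegral_congr fun z => ?_
  rw [laplace₂]
  ring

lemma lintegral_laplace₂_snd {ε : ℝ} (hε : 0 < ε) {f : ℝ → ℝ≥0∞} (hf : Measurable f) :
    ∫⁻ z, laplace₂ ε z * f z.2 = ∫⁻ z, laplace ε z * f z := by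
  have h := lintegral_prod_mul (μ := (volume : Measure ℝ)) (ν := (volume : Measure ℝ))
    (f := laplace ε) (g := fun z => laplace ε z * f z) (by fun_prop) (by fun_prop)
  rw [lintegral_laplace hε, one_mul, ← Measure.volume_eq_prod] at h
  rw [← h]
  refine lintegral_congr fun z => ?_
  rw [laplace₂]
  ring

lemma lintegral_laplace₂ {ε : ℝ} (hε : 0 < ε) : ∫⁻ z, laplace₂ ε z = 1 := by
  simpa [lintegral_laplace hε] using lintegral_laplace₂_fst hε (f := fun _ => 1) measurable_const

lemma laplace₂_sub_le {ε : ℝ} (hε : 0 < ε) (y s s' : ℝ × ℝ) :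
    laplace₂ ε (y - s)
      ≤ ENNReal.ofReal (Real.exp (ε * (|s.1 - s'.1| + |s.2 - s'.2|))) * laplace₂ ε (y - s') := by
  have h := mul_le_mul' (laplace_sub_le hε y.1 s.1 s'.1) (laplace_sub_le hε y.2 s.2 s'.2)
  rw [mul_add, Real.exp_add, ENNReal.ofReal_mul (Real.exp_pos _).le]
  refine h.trans (le_of_eq ?_)
  simp only [laplace₂, Prod.fst_sub, Prod.snd_sub]
  ring

lemma lintegral_laplace₂_moments {ε a b d : ℝ} (hε : 0 < ε) (ha : 0 ≤ a) (hb : 0 ≤ b)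
    (hd : 0 ≤ d) :
    ∫⁻ z, laplace₂ ε z *
        ENNReal.ofReal (a * |z.1| ^ 2 + b * |z.2| ^ 2 + d * |z.1| ^ 4 + d * |z.2| ^ 4)
      = ENNReal.ofReal (2 * (a + b) / ε ^ 2 + 48 * d / ε ^ 4) := by
  have e : ∀ z : ℝ × ℝ, laplace₂ ε z *
        ENNReal.ofReal (a * |z.1| ^ 2 + b * |z.2| ^ 2 + d * |z.1| ^ 4 + d * |z.2| ^ 4)
      = ENNReal.ofReal a * (laplace₂ ε z * ENNReal.ofReal (|z.1| ^ 2))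
        + ENNReal.ofReal b * (laplace₂ ε z * ENNReal.ofReal (|z.2| ^ 2))
        + ENNReal.ofReal d * (laplace₂ ε z * ENNReal.ofReal (|z.1| ^ 4))
        + ENNReal.ofReal d * (laplace₂ ε z * ENNReal.ofReal (|z.2| ^ 4)) := by
    intro z
    rw [ENNReal.ofReal_add (by positivity) (by positivity),
      ENNReal.ofReal_add (by positivity) (by positivity),
      ENNReal.ofReal_add (by positivity) (by positivity), ENNReal.ofReal_mul ha,
      ENNReal.ofReal_mul hb, ENNReal.ofReal_mul hd, ENNReal.ofReal_mul hd]
    ring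
  have m1 : ∀ k : ℕ, ∫⁻ z, laplace₂ ε z * ENNReal.ofReal (|z.1| ^ k)
      = ENNReal.ofReal ((k.factorial : ℝ) / ε ^ k) := fun k => by
    rw [lintegral_laplace₂_fst hε (f := fun x => ENNReal.ofReal (|x| ^ k)) (by fun_prop),
      lintegral_laplace_moment hε]
  have m2 : ∀ k : ℕ, ∫⁻ z, laplace₂ ε z * ENNReal.ofReal (|z.2| ^ k)
      = ENNReal.ofReal ((k.factorial : ℝ) / ε ^ k) := fun k => by
    rw [lintegral_laplace₂_snd hε (f := fun x => ENNReal.ofReal (|x| ^ k)) (by fun_prop),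
      lintegral_laplace_moment hε]
  simp_rw [e]
  rw [lintegral_add_left (by fun_prop), lintegral_add_left (by fun_prop),
    lintegral_add_left (by fun_prop), lintegral_const_mul _ (by fun_prop),
    lintegral_const_mul _ (by fun_prop), lintegral_const_mul _ (by fun_prop),
    lintegral_const_mul _ (by fun_prop), m1, m1, m2, m2, ← ENNReal.ofReal_mul ha,
    ← ENNReal.ofReal_mul hb, ← ENNReal.ofReal_mul hd, ← ENNReal.ofReal_add (by positivity)
    (by positivity), ← ENNReal.ofReal_add (by positivity) (by positivity),
    ← ENNReal.ofReal_add (by positivity) (by positivity)]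
  congr 1
  simp only [Nat.factorial]
  push_cast
  ring

/-! ### Sums of normalized data -/

/-- The position of a point of `[l, u]`, normalized to `[0, 1]`. If `l = u` the junk value of the
division makes it `0`, which is harmless. -/
noncomputable def pos (x : Set.Icc l u) : ℝ := ((x : ℝ) - l) / (u - l)

lemma pos_nonneg (x : Set.Icc l u) : 0 ≤ pos x :=
  div_nonneg (by linarith [x.2.1]) (by linarith [x.2.1, x.2.2])

lemma pos_le_one (x : Set.Icc l u) : pos x ≤ 1 :=
  div_le_one_of_le₀ (by linarith [x.2.2]) (by linarith [x.2.1, x.2.2])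

lemma coe_eq_pos (x : Set.Icc l u) : (x : ℝ) = l + (u - l) * pos x := by
  unfold pos
  rcases eq_or_ne (u - l) 0 with h | h
  · rw [h]
    linarith [x.2.1, x.2.2]
  · field_simp
    ring

/-- The sum of the normalized data. -/
noncomputable def posSum (D : Dataset l u) : ℝ := (D.map pos).sum

lemma posSum_add (D E : Dataset l u) : posSum (D + E) = posSum D + posSum E := by
  simp [posSum]

@[simp]
lemma posSum_singleton (x : Set.Icc l u) : posSum {x} = pos x := by
  simp [posSum]

lemma posSum_bounds (D : Dataset l u) : 0 ≤ posSum D ∧ posSum D ≤ D.card := by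
  induction D using Multiset.induction with
  | empty => simp [posSum]
  | cons x D ih =>
    rw [← Multiset.singleton_add, posSum_add, posSum_singleton, Multiset.card_add,
      Multiset.card_singleton]
    push_cast
    constructor <;> linarith [pos_nonneg x, pos_le_one x]

lemma mean_eq_posSum {D : Dataset l u} (hD : 0 < D.card) :
    mean D = l + (u - l) * (posSum D / D.card) := by
  have h : (Multiset.map Subtype.val D).sum = l * D.card + (u - l) * posSum D := by
    clear hD
    induction D using Multiset.induction with
    | empty => simp [posSum]
    | cons x D ih =>
      rw [Multiset.map_cons, Multiset.sum_cons, ih, ← Multiset.singleton_add, posSum_add,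
        posSum_singleton, Multiset.card_add, Multiset.card_singleton, coe_eq_pos x]
      push_cast
      ring
  have : (D.card : ℝ) ≠ 0 := by exact_mod_cast hD.ne'
  rw [mean_eq, h]
  field_simp

lemma posSum_sub_posSum (D D' : Dataset l u) :
    posSum D - posSum D' = posSum (D - D') - posSum (D' - D) := by
  have h1 := congrArg posSum (Multiset.sub_add_inter D D')
  have h2 := congrArg posSum (Multiset.sub_add_inter D' D)
  rw [posSum_add] at h1 h2
  rw [Multiset.inter_comm] at h2
  linarith

lemma card_sub_card (D D' : Dataset l u) :
    (D.card : ℝ) - D'.card = (D - D').card - (D' - D).card := by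
  have h1 := congrArg Multiset.card (Multiset.sub_add_inter D D')
  have h2 := congrArg Multiset.card (Multiset.sub_add_inter D' D)
  rw [Multiset.card_add] at h1 h2
  rw [Multiset.inter_comm] at h2
  rw [← h1, ← h2]
  push_cast
  ring

lemma SwapNeighbor.card_eq {D D' : Dataset l u} (h : SwapNeighbor D D') : D.card = D'.card := by
  have := card_sub_card D D'
  rw [h.1, h.2, sub_self, sub_eq_zero] at this
  exact_mod_cast this

lemma SwapNeighbor.abs_posSum_sub_le {D D' : Dataset l u} (h : SwapNeighbor D D') :
    |posSum D - posSum D'| ≤ 1 := by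
  obtain ⟨x, hx⟩ := Multiset.card_eq_one.1 h.1
  obtain ⟨y, hy⟩ := Multiset.card_eq_one.1 h.2
  rw [posSum_sub_posSum, hx, hy, posSum_singleton, posSum_singleton, abs_le]
  constructor <;> linarith [pos_nonneg x, pos_le_one x, pos_nonneg y, pos_le_one y]

/-- The statistic `(∑ pos, ∑ (1 - pos))` has sensitivity `1` in the `ℓ¹` norm. -/
lemma AddRemoveNeighbor.sensitivity {D D' : Dataset l u} (h : AddRemoveNeighbor D D') :
    |posSum D - posSum D'| + |(D.card - posSum D) - (D'.card - posSum D')| ≤ 1 := by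
  have hc := card_sub_card D D'
  have hp := posSum_sub_posSum D D'
  have hq : ((D.card : ℝ) - posSum D) - (D'.card - posSum D')
      = (D.card - D'.card) - (posSum D - posSum D') := by ring
  have b1 := posSum_bounds (D - D')
  have b2 := posSum_bounds (D' - D)
  have hsum : ((D - D').card : ℝ) + (D' - D).card = 1 := by exact_mod_cast h
  rw [hq, hp, hc]
  refine (add_le_add (abs_sub _ _) (le_of_eq_of_le ?_ (abs_sub
    ((D - D').card - posSum (D - D')) ((D' - D).card - posSum (D' - D))))).trans ?_
  · congr 1
    ring
  · rw [abs_of_nonneg b1.1, abs_of_nonneg b2.1, abs_of_nonneg (by linarith),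
      abs_of_nonneg (by linarith)]
    linarith

/-! ### Private estimators attaining the bound -/

/-- The point of `[l, u]` whose normalized position is `v`, truncated to `[0, 1]`. -/
noncomputable def toIcc (h : l ≤ u) (v : ℝ) : Set.Icc l u :=
  ⟨l + (u - l) * Set.projIcc (0 : ℝ) 1 zero_le_one v, by
    have h1 := (Set.projIcc (0 : ℝ) 1 zero_le_one v).2.1
    have h2 := (Set.projIcc (0 : ℝ) 1 zero_le_one v).2.2
    constructor <;> nlinarith⟩

@[fun_prop]
lemma measurable_toIcc (h : l ≤ u) : Measurable (toIcc h) := by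
  refine Measurable.subtype_mk ?_
  have : Measurable (Set.projIcc (0 : ℝ) 1 zero_le_one) := continuous_projIcc.measurable
  fun_prop

lemma sq_projIcc_sub_le {m : ℝ} (hm0 : 0 ≤ m) (hm1 : m ≤ 1) (v : ℝ) :
    ((Set.projIcc (0 : ℝ) 1 zero_le_one v : ℝ) - m) ^ 2 ≤ (v - m) ^ 2 := by
  have h := Set.abs_projIcc_sub_projIcc (zero_le_one' ℝ) (c := v) (d := m)
  rw [Set.projIcc_of_mem zero_le_one ⟨hm0, hm1⟩] at h
  exact sq_le_sq.2 h

lemma sq_projIcc_sub_le_one {m : ℝ} (hm0 : 0 ≤ m) (hm1 : m ≤ 1) (v : ℝ) :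
    ((Set.projIcc (0 : ℝ) 1 zero_le_one v : ℝ) - m) ^ 2 ≤ 1 := by
  have h1 := (Set.projIcc (0 : ℝ) 1 zero_le_one v).2.1
  have h2 := (Set.projIcc (0 : ℝ) 1 zero_le_one v).2.2
  rw [sq_le_one_iff_abs_le_one, abs_le]
  constructor <;> linarith

/-- The estimator that post-processes a random element of `G` with law `ν D` by the map `T D`. -/
noncomputable def postProcess {G : Type*} [MeasurableSpace G] (ν : Dataset l u → Measure G)
    (hν : ∀ D, IsProbabilityMeasure (ν D)) (T : Dataset l u → G → Set.Icc l u)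
    (hT : ∀ D, Measurable (T D)) : Estimator l u :=
  fun D => ⟨(ν D).map (T D), Measure.isProbabilityMeasure_map (hT D).aemeasurable⟩

lemma isDP_postProcess {G : Type*} [MeasurableSpace G] {ν : Dataset l u → Measure G}
    {hν : ∀ D, IsProbabilityMeasure (ν D)} {T : Dataset l u → G → Set.Icc l u}
    {hT : ∀ D, Measurable (T D)} {nbr : Dataset l u → Dataset l u → Prop} {ε : ℝ}
    (h : ∀ D D', nbr D D' → T D = T D' ∧ ν D ≤ ENNReal.ofReal (Real.exp ε) • ν D') :
    IsDP nbr ε (postProcess ν hν T hT) := by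
  intro D D' hn S hS
  obtain ⟨h1, h2⟩ := h D D' hn
  simp only [postProcess, ProbabilityMeasure.coe_mk]
  rw [Measure.map_apply (hT D) hS, Measure.map_apply (hT D') hS, h1]
  exact h2 _

lemma normMSE_postProcess {G : Type*} [MeasurableSpace G] {ν : Dataset l u → Measure G}
    {hν : ∀ D, IsProbabilityMeasure (ν D)} {T : Dataset l u → G → Set.Icc l u}
    {hT : ∀ D, Measurable (T D)} (D : Dataset l u) :
    normMSE (postProcess ν hν T hT) D
      = ∫⁻ y, ENNReal.ofReal ((D.card : ℝ) ^ 2 * ((T D y : ℝ) - mean D) ^ 2) ∂(ν D) := by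
  simp only [normMSE, mse, postProcess, ProbabilityMeasure.coe_mk]
  have hTD := hT D
  rw [lintegral_map (by fun_prop) hTD, ← lintegral_const_mul _ (by fun_prop)]
  refine lintegral_congr fun y => ?_
  rw [ENNReal.ofReal_mul (by positivity), ENNReal.ofReal_pow (Nat.cast_nonneg D.card),
    ENNReal.ofReal_natCast]

lemma minmaxRisk_le {nbr : Dataset l u → Dataset l u → Prop} {ε : ℝ} {n : ℕ} {M : Estimator l u}
    (hM : IsDP nbr ε M) {T : ℝ≥0∞} (h : ∀ D : Dataset l u, n ≤ D.card → normMSE M D ≤ T) :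
    minmaxRisk nbr ε n ≤ T :=
  iInf₂_le_of_le M hM (iSup₂_le h)

/-- In the swap model the size of the dataset is public, and Laplace noise on the sum is enough. -/
lemma riskSW_upper_bound {ε : ℝ} {n : ℕ} (hε : 0 < ε) (hn : 1 ≤ n) (hlu : l ≤ u) :
    riskSW ε n l u ≤ ENNReal.ofReal (2 * (u - l) ^ 2 / ε ^ 2) := by
  refine minmaxRisk_le (M := postProcess (fun D => shiftNoise (laplace ε) (posSum D))
    (fun D => isProbabilityMeasure_shiftNoise (by fun_prop) (lintegral_laplace hε) _)
    (fun D y => toIcc hlu (y / D.card)) (fun D => by fun_prop)) ?_ ?_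
  · refine isDP_postProcess fun D D' h => ⟨by rw [h.card_eq], ?_⟩
    refine shiftNoise_le (by fun_prop) fun y => (laplace_sub_le hε y _ (posSum D')).trans ?_
    have := h.abs_posSum_sub_le
    gcongr
    exact mul_le_of_le_one_right hε.le this
  · intro D hD
    have hc : 0 < D.card := by omega
    have hc' : (0 : ℝ) < D.card := by exact_mod_cast hc
    have hb := posSum_bounds D
    rw [normMSE_postProcess, lintegral_shiftNoise (by fun_prop) _ (by fun_prop),
      mean_eq_posSum hc]
    calc _ ≤ ∫⁻ z, ENNReal.ofReal ((u - l) ^ 2) * (laplace ε z * ENNReal.ofReal (|z| ^ 2)) := by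
          refine lintegral_mono fun z => ?_
          rw [mul_left_comm, ← ENNReal.ofReal_mul (by positivity)]
          refine mul_le_mul' le_rfl (ENNReal.ofReal_le_ofReal ?_)
          have h := sq_projIcc_sub_le (m := posSum D / D.card) (div_nonneg hb.1 hc'.le)
            ((div_le_one hc').2 hb.2) ((z + posSum D) / D.card)
          have e : (D.card : ℝ) ^ 2 * ((z + posSum D) / D.card - posSum D / D.card) ^ 2
              = |z| ^ 2 := by
            rw [sq_abs]
            field_simp
            ring
          calc _ = (u - l) ^ 2 * ((D.card : ℝ) ^ 2 *
                  (Set.projIcc (0 : ℝ) 1 zero_le_one ((z + posSum D) / D.card)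
                    - posSum D / D.card) ^ 2) := by
                simp only [toIcc]
                ring
            _ ≤ (u - l) ^ 2 * ((D.card : ℝ) ^ 2 *
                  ((z + posSum D) / D.card - posSum D / D.card) ^ 2) := by gcongr
            _ = _ := by rw [e]
      _ = _ := by
          rw [lintegral_const_mul _ (by fun_prop), lintegral_laplace_moment hε,
            ← ENNReal.ofReal_mul (by positivity)]
          congr 1
          simp only [Nat.factorial]
          push_cast
          ring

/-- The pointwise error of the ratio estimator. If the noise in the denominator is at most `η n`,
then the error is `(1 - m) z₁ - m z₂` up to a factor `1 / (1 - η)`, where `m = S / n`; otherwise the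
trivial bound applies, and the fourth powers dominate. -/
lemma ratio_error_le {n S η : ℝ} (hn : 0 < n) (hS0 : 0 ≤ S) (hSn : S ≤ n) (hη : 0 < η)
    (hη1 : η < 1) (x y : ℝ) :
    n ^ 2 * ((Set.projIcc (0 : ℝ) 1 zero_le_one ((x + S) / (x + S + (y + (n - S)))) : ℝ)
        - S / n) ^ 2
      ≤ 1 / (1 - η) ^ 2 * (1 - S / n) * |x| ^ 2 + 1 / (1 - η) ^ 2 * (S / n) * |y| ^ 2
        + 8 / (η ^ 4 * n ^ 2) * |x| ^ 4 + 8 / (η ^ 4 * n ^ 2) * |y| ^ 4 := by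
  obtain ⟨m, hm⟩ : ∃ m, m = S / n := ⟨_, rfl⟩
  have hm0 : 0 ≤ m := hm ▸ div_nonneg hS0 hn.le
  have hm1 : m ≤ 1 := hm ▸ (div_le_one hn).2 hSn
  have hS : S = m * n := by rw [hm]; field_simp
  have hη' : 0 < 1 - η := by linarith
  have hm1' : 0 ≤ 1 - m := by linarith
  have p4 : ∀ t : ℝ, |t| ^ 4 = t ^ 4 := fun t => Even.pow_abs (by decide) t
  rw [← hm, sq_abs, sq_abs, p4, p4, hS, show x + m * n + (y + (n - m * n)) = n + (x + y) by ring]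
  have hd : 0 ≤ 8 / (η ^ 4 * n ^ 2) * x ^ 4 + 8 / (η ^ 4 * n ^ 2) * y ^ 4 := by positivity
  rcases le_or_gt |x + y| (η * n) with hw | hw
  · have hden : (1 - η) * n ≤ n + (x + y) := by linarith [(abs_le.1 hw).1]
    have hden0 : 0 < n + (x + y) := lt_of_lt_of_le (by positivity) hden
    have h1 := sq_projIcc_sub_le hm0 hm1 ((x + m * n) / (n + (x + y)))
    have h2 : n ^ 2 * ((x + m * n) / (n + (x + y)) - m) ^ 2
        = (n / (n + (x + y))) ^ 2 * ((1 - m) * x - m * y) ^ 2 := by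
      field_simp
      ring
    have h3 : n / (n + (x + y)) ≤ 1 / (1 - η) := by
      rw [div_le_div_iff₀ hden0 hη']
      linarith
    have h4 : ((1 - m) * x - m * y) ^ 2 ≤ (1 - m) * x ^ 2 + m * y ^ 2 := by
      have : 0 ≤ m * (1 - m) * (x + y) ^ 2 := by positivity
      linarith
    have h5 : n ^ 2 * ((x + m * n) / (n + (x + y)) - m) ^ 2
        ≤ (1 / (1 - η)) ^ 2 * ((1 - m) * x ^ 2 + m * y ^ 2) := by
      rw [h2]
      gcongr
    have h6 : (1 / (1 - η)) ^ 2 * ((1 - m) * x ^ 2 + m * y ^ 2)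
        = 1 / (1 - η) ^ 2 * (1 - m) * x ^ 2 + 1 / (1 - η) ^ 2 * m * y ^ 2 := by
      rw [one_div_pow]
      ring
    have h7 := mul_le_mul_of_nonneg_left h1 (sq_nonneg n)
    linarith
  · have h1 := sq_projIcc_sub_le_one hm0 hm1 ((x + m * n) / (n + (x + y)))
    have h2 : (η * n) ^ 4 ≤ (x + y) ^ 4 := by
      rw [← p4 (x + y)]
      gcongr
    have h3 : (x + y) ^ 4 ≤ 8 * (x ^ 4 + y ^ 4) := by
      have e1 : (x + y) ^ 2 ≤ 2 * (x ^ 2 + y ^ 2) := add_sq_le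
      have e2 : (x ^ 2 + y ^ 2) ^ 2 ≤ 2 * ((x ^ 2) ^ 2 + (y ^ 2) ^ 2) := add_sq_le
      have e3 : ((x + y) ^ 2) ^ 2 ≤ (2 * (x ^ 2 + y ^ 2)) ^ 2 := by gcongr
      linarith
    have h4 : n ^ 2 ≤ 8 / (η ^ 4 * n ^ 2) * x ^ 4 + 8 / (η ^ 4 * n ^ 2) * y ^ 4 := by
      have : 8 / (η ^ 4 * n ^ 2) * x ^ 4 + 8 / (η ^ 4 * n ^ 2) * y ^ 4
          = 8 * (x ^ 4 + y ^ 4) / (η ^ 4 * n ^ 2) := by ring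
      rw [this, le_div_iff₀ (by positivity)]
      linarith
    have h5 : 0 ≤ 1 / (1 - η) ^ 2 * (1 - m) * x ^ 2 + 1 / (1 - η) ^ 2 * m * y ^ 2 := by
      positivity
    have h7 := mul_le_mul_of_nonneg_left h1 (sq_nonneg n)
    linarith

/-- The estimator adds independent Laplace noise to `∑ pos` and to `∑ (1 - pos)`, and takes the
ratio of the first to the sum of the two. -/
lemma riskAR_upper_bound {ε η : ℝ} {n : ℕ} (hε : 0 < ε) (hn : 1 ≤ n) (hη : 0 < η) (hη1 : η < 1)
    (hlu : l ≤ u) :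
    riskAR ε n l u ≤ ENNReal.ofReal
      (2 * (u - l) ^ 2 / ε ^ 2 * (1 / (1 - η) ^ 2 + 192 / (η ^ 4 * (n * ε) ^ 2))) := by
  refine minmaxRisk_le (M := postProcess
    (fun D => shiftNoise (laplace₂ ε) (posSum D, D.card - posSum D))
    (fun D => isProbabilityMeasure_shiftNoise (by fun_prop) (lintegral_laplace₂ hε) _)
    (fun D y => toIcc hlu (y.1 / (y.1 + y.2))) (fun D => by fun_prop)) ?_ ?_
  · refine isDP_postProcess fun D D' h => ⟨rfl, ?_⟩
    refine shiftNoise_le (by fun_prop) fun y =>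
      (laplace₂_sub_le hε y _ (posSum D', D'.card - posSum D')).trans ?_
    have := h.sensitivity
    gcongr
    exact mul_le_of_le_one_right hε.le this
  · intro D hD
    have hn' : (0 : ℝ) < n := by exact_mod_cast hn
    have hc : 0 < D.card := by omega
    have hc' : (0 : ℝ) < D.card := by exact_mod_cast hc
    have hb := posSum_bounds D
    have hη' : 0 < 1 - η := by linarith
    have hm0 : 0 ≤ posSum D / D.card := div_nonneg hb.1 hc'.le
    have hm1 : 0 ≤ 1 - posSum D / D.card := sub_nonneg.2 ((div_le_one hc').2 hb.2)
    rw [normMSE_postProcess, lintegral_shiftNoise (by fun_prop) _ (by fun_prop),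
      mean_eq_posSum hc]
    calc _ ≤ ∫⁻ z, ENNReal.ofReal ((u - l) ^ 2) * (laplace₂ ε z * ENNReal.ofReal
            (1 / (1 - η) ^ 2 * (1 - posSum D / D.card) * |z.1| ^ 2
              + 1 / (1 - η) ^ 2 * (posSum D / D.card) * |z.2| ^ 2
              + 8 / (η ^ 4 * (D.card : ℝ) ^ 2) * |z.1| ^ 4
              + 8 / (η ^ 4 * (D.card : ℝ) ^ 2) * |z.2| ^ 4)) := by
          refine lintegral_mono fun z => ?_
          rw [mul_left_comm, ← ENNReal.ofReal_mul (by positivity)]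
          refine mul_le_mul' le_rfl (ENNReal.ofReal_le_ofReal ?_)
          refine le_trans (le_of_eq ?_) (mul_le_mul_of_nonneg_left
            (ratio_error_le hc' hb.1 hb.2 hη hη1 z.1 z.2) (sq_nonneg _))
          simp only [toIcc, Prod.fst_add, Prod.snd_add]
          ring
      _ = ENNReal.ofReal (2 * (u - l) ^ 2 / ε ^ 2 *
            (1 / (1 - η) ^ 2 + 192 / (η ^ 4 * (D.card * ε) ^ 2))) := by
          rw [lintegral_const_mul _ (by fun_prop), lintegral_laplace₂_moments hε (by positivity)
            (by positivity) (by positivity), ← ENNReal.ofReal_mul (by positivity)]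
          congr 1
          field_simp
          ring
      _ ≤ _ := by
          have : (n : ℝ) ≤ D.card := by exact_mod_cast hD
          gcongr

/-! ### Asymptotics -/

lemma eventually_regime {c : ℝ} (hc : 0 < c) (C : ℝ) :
    ∀ᶠ p : ℕ × ℝ in regime, 1 ≤ p.1 ∧ 0 < p.2 ∧ p.2 ≤ c ∧ C ≤ p.1 * p.2 := by
  have h1 : ∀ᶠ p : ℕ × ℝ in regime, 1 ≤ p.1 :=
    ((tendsto_fst (f := (atTop : Filter ℕ)) (g := 𝓝[>] (0 : ℝ))).mono_left inf_le_left).eventually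
      (eventually_ge_atTop 1)
  have h2 : ∀ᶠ p : ℕ × ℝ in regime, p.2 ∈ Set.Ioc 0 c :=
    ((tendsto_snd (f := (atTop : Filter ℕ)) (g := 𝓝[>] (0 : ℝ))).mono_left inf_le_left).eventually
      (Ioc_mem_nhdsGT hc)
  have h3 : ∀ᶠ p : ℕ × ℝ in regime, C ≤ p.1 * p.2 :=
    ((tendsto_comap (f := fun p : ℕ × ℝ => (p.1 : ℝ) * p.2) (x := atTop)).mono_left
      inf_le_right).eventually (eventually_ge_atTop C)
  filter_upwards [h1, h2, h3] with p a b c using ⟨a, b.1, b.2, c⟩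

end PrivateMean

theorem mainTheorem2 :
    -- lower bound in the add-remove model, with an `o(1)` term that does not depend on `l`, `u`
    (∀ δ : ℝ, 0 < δ → ∀ᶠ p : ℕ × ℝ in PrivateMean.regime, ∀ l u : ℝ, l ≤ u →
      ENNReal.ofReal (2 * (u - l) ^ 2 / p.2 ^ 2 * (1 - δ)) ≤ PrivateMean.riskAR p.2 p.1 l u) ∧
    -- matching upper bound in the add-remove model
    (∀ δ : ℝ, 0 < δ → ∀ᶠ p : ℕ × ℝ in PrivateMean.regime, ∀ l u : ℝ, l ≤ u →
      PrivateMean.riskAR p.2 p.1 l u ≤ ENNReal.ofReal (2 * (u - l) ^ 2 / p.2 ^ 2 * (1 + δ))) ∧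
    -- the swap model has the same asymptotics
    (∀ δ : ℝ, 0 < δ → ∀ᶠ p : ℕ × ℝ in PrivateMean.regime, ∀ l u : ℝ, l ≤ u →
      ENNReal.ofReal (2 * (u - l) ^ 2 / p.2 ^ 2 * (1 - δ)) ≤ PrivateMean.riskSW p.2 p.1 l u ∧
      PrivateMean.riskSW p.2 p.1 l u ≤ ENNReal.ofReal (2 * (u - l) ^ 2 / p.2 ^ 2 * (1 + δ))) := by
  -- The lower bounds only get stronger when `δ` decreases to `min δ 1`, and are trivial if `l = u`.
  have lower : ∀ {δ ε l u : ℝ} {R : ℝ≥0∞}, l ≤ u →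
      (l < u → ENNReal.ofReal (2 * (u - l) ^ 2 / ε ^ 2 * (1 - min δ 1)) ≤ R) →
      ENNReal.ofReal (2 * (u - l) ^ 2 / ε ^ 2 * (1 - δ)) ≤ R := by
    intro δ ε l u R hlu h
    rcases hlu.eq_or_lt with rfl | hlt
    · simp
    · refine le_trans (ENNReal.ofReal_le_ofReal ?_) (h hlt)
      have := min_le_left δ 1
      gcongr
  refine ⟨fun δ hδ => ?_, fun δ hδ => ?_, fun δ hδ => ?_⟩ <;>
    have hd : 0 < min δ 1 := lt_min hδ one_pos <;>
    have hd1 : min δ 1 ≤ 1 := min_le_right _ _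
  · filter_upwards [PrivateMean.eventually_regime (c := min δ 1 / 20) (by positivity)
      (2010 / min δ 1 ^ 2)] with p ⟨_, hε, hεd, hp⟩ l u hlu
    exact lower hlu fun hlt => PrivateMean.riskAR_lower_bound hd hd1 hε hεd hp hlt
  · filter_upwards [PrivateMean.eventually_regime one_pos (2000 / min δ 1 ^ 3)]
      with p ⟨hn, hε, _, hp⟩ l u hlu
    refine (PrivateMean.riskAR_upper_bound (η := min δ 1 / 8) hε hn (by positivity) (by linarith)
      hlu).trans (ENNReal.ofReal_le_ofReal ?_)
    obtain ⟨d, hdd⟩ : ∃ d, d = min δ 1 := ⟨_, rfl⟩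
    have hle : d ≤ δ := hdd ▸ min_le_left δ 1
    rw [← hdd] at hd hd1 hp ⊢
    have h1 : 1 / (1 - d / 8) ^ 2 ≤ 1 + d / 2 := by
      have : 0 < 1 - d / 8 := by linarith
      rw [div_le_iff₀ (by positivity)]
      nlinarith [mul_pos hd hd, mul_pos (mul_pos hd hd) hd]
    have h2 : 192 / ((d / 8) ^ 4 * (p.1 * p.2) ^ 2) ≤ d / 2 := by
      calc 192 / ((d / 8) ^ 4 * (p.1 * p.2) ^ 2)
          ≤ 192 / ((d / 8) ^ 4 * (2000 / d ^ 3) ^ 2) := by gcongr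
        _ = 192 * 4096 / 4000000 * d ^ 2 := by field_simp; norm_num
        _ ≤ d / 2 := by nlinarith
    have h3 : 1 / (1 - d / 8) ^ 2 + 192 / ((d / 8) ^ 4 * (p.1 * p.2) ^ 2) ≤ 1 + δ := by linarith
    gcongr
  · filter_upwards [PrivateMean.eventually_regime (c := min δ 1 / 10) (by positivity)
      (100 / min δ 1)] with p ⟨hn, hε, hεd, hp⟩ l u hlu
    refine ⟨lower hlu fun hlt => PrivateMean.riskSW_lower_bound hd hd1 hε hεd hp hlt,
      (PrivateMean.riskSW_upper_bound hε hn hlu).trans (ENNReal.ofReal_le_ofReal ?_)⟩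
    exact le_mul_of_one_le_right (by positivity) (by linarith)
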